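/- Let $n\ge 1$. For $\pi\in S_n$ let $P_\pi$ be the $n\times n$ permutation matrix whose $(i,j)$ entry is $1$ if $\pi(j)=i$ and $0$ otherwise. Let $B_-$ and $B_+$ be the groups of invertible lower and upper triangular complex $n\times n$ matrices, and let the matrix Schubert variety $\overline{X_\pi}$ be the Zariski closure of $B_-P_\pi B_+$ in the space $\mathbb{C}^{n^2}$ of $n\times n$ matrices. Let $D(\pi)=\{(\pi(j),i): i<j,\ \pi(i)>\pi(j)\}$ be the Rothe diagram. Let $NW(\pi)$ be the set of boxes of the $n\times n$ grid that are weakly north-west of some box of $D(\pi)$. Let $dom(\pi)$ be the connected component of $D(\pi)$ containing the box $(1,1)$, or $\emptyset$ if $\pi(1)=1$. Put $L(\pi)=NW(\pi)\setminus dom(\pi)$, and let $Y_\pi\subseteq\mathbb{C}^{L(\pi)}$ be the projection of $\overline{X_\pi}$ onto the entries in $L(\pi)$. Let $T^{2n-1}=T^{2n}/\{(aI,aI): a\in\mathbb{C}^*\}$, where $T^{2n}$ is the group of pairs $(A,B)$ of invertible diagonal complex $n\times n$ matrices; it acts on matrices by $M\mapsto AMB^{-1}$, and hence on $\mathbb{C}^{L(\pi)}$: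 if $A$ and $B$ have diagonal entries $a_1,\dots,a_n$ and $b_1,\dots,b_n$, then $(A,B)$ multiplies the coordinate $(i,j)$ by $a_ib_j^{-1}$. Let $\pi'$ be a dominant permutation of $\{2,\dots,n\}$, that is, its diagram is (possibly empty and) the Young diagram of a partition whose north-west corner is the box $(2,2)$, and let $1\pi'\in S_n$ be the permutation that fixes $1$ and acts as $\pi'$ on $\{2,\dots,n\}$. Then $Y_{1\pi'}$ is a toric variety with respect to the $T^{2n-1}$-action: it is a Zariski closed, irreducible, normal, $T^{2n-1}$-stable subvariety of $\mathbb{C}^{L(1\pi')}$ containing a $T^{2n-1}$-orbit that is open and dense in it. -/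

import Mathlib

namespace MatrixSchubert

/-! ### Permutations, diagrams and regions of the grid

Rows and columns of an `n × n` grid are indexed by `Fin n` (from `0`), and a box is a pair
`(row, column)`. -/

/-- The permutation matrix of `π`: the entry `(i, j)` is `1` if `π j = i`, and `0` otherwise. -/
def permMat {n : ℕ} (π : Equiv.Perm (Fin n)) : Matrix (Fin n) (Fin n) ℂ :=
  Matrix.of fun i j => if π j = i then 1 else 0

/-- The Rothe diagram `D(π) = {(π_j, i) : i < j, π_i > π_j}`. -/
def diagram {n : ℕ} (π : Equiv.Perm (Fin n)) : Set (Fin n × Fin n) :=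
  {b | ∃ i j : Fin n, i < j ∧ π j < π i ∧ b = (π j, i)}

/-- Two boxes of the grid share an edge. -/
def BoxAdj {n : ℕ} (b c : Fin n × Fin n) : Prop :=
  (b.1 = c.1 ∧ (b.2.val + 1 = c.2.val ∨ c.2.val + 1 = b.2.val)) ∨
    (b.2 = c.2 ∧ (b.1.val + 1 = c.1.val ∨ c.1.val + 1 = b.1.val))

/-- The dominant piece `dom(π)`: the connected component of the diagram that contains the
north-west corner of the grid (empty if the corner is not in the diagram). -/
def dominantPiece {n : ℕ} (π : Equiv.Perm (Fin n)) : Set (Fin n × Fin n) :=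
  {b | ∃ c ∈ diagram π, c.1.val = 0 ∧ c.2.val = 0 ∧
    Relation.ReflTransGen
      (fun x y => x ∈ diagram π ∧ y ∈ diagram π ∧ BoxAdj x y) c b}

/-- `NW(π)`: the boxes (weakly) north-west of some box of the diagram. -/
def northWest {n : ℕ} (π : Equiv.Perm (Fin n)) : Set (Fin n × Fin n) :=
  {b | ∃ c ∈ diagram π, b.1 ≤ c.1 ∧ b.2 ≤ c.2}

/-- `L(π) = NW(π) - dom(π)`. -/
def regionL {n : ℕ} (π : Equiv.Perm (Fin n)) : Set (Fin n × Fin n) :=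
  northWest π \ dominantPiece π

/-- A permutation is dominant if its diagram is the Young diagram of a partition placed in the
north-west corner of the grid: with a box it contains every box weakly north-west of it. -/
def IsDominant {n : ℕ} (π : Equiv.Perm (Fin n)) : Prop :=
  IsLowerSet (diagram π)

/-- The permutation `1π'`: it fixes the first element and acts as `π'` on the remaining ones
(`0 ↦ 0` and `i + 1 ↦ π' i + 1`). -/
def oneCross {n : ℕ} (π' : Equiv.Perm (Fin n)) : Equiv.Perm (Fin (n + 1)) :=
  Equiv.Perm.decomposeFin.symm (0, π')

/-! ### Zariski topology on the complex affine space with coordinates indexed by `σ` -/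

/-- The Zariski closure: the common zeros of all polynomials that vanish on the set. -/
def zariskiClosure {σ : Type*} (S : Set (σ → ℂ)) : Set (σ → ℂ) :=
  MvPolynomial.zeroLocus ℂ (MvPolynomial.vanishingIdeal ℂ S)

/-- Zariski closed sets. -/
def IsZariskiClosed {σ : Type*} (S : Set (σ → ℂ)) : Prop :=
  zariskiClosure S = S

/-! ### Matrix Schubert varieties -/

/-- The orbit `B_- π B_+` of the permutation matrix of `π` under `(X, Y) · M = X M Y⁻¹`, with `X`
invertible lower triangular and `Y` invertible upper triangular. A matrix is given by the
function of its entries. -/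
def borelOrbit {n : ℕ} (π : Equiv.Perm (Fin n)) : Set (Fin n × Fin n → ℂ) :=
  {M | ∃ X Y : GL (Fin n) ℂ,
    (∀ i j : Fin n, i < j → (X : Matrix (Fin n) (Fin n) ℂ) i j = 0) ∧
    (∀ i j : Fin n, j < i → (Y : Matrix (Fin n) (Fin n) ℂ) i j = 0) ∧
    ∀ b : Fin n × Fin n,
      M b = ((X : Matrix (Fin n) (Fin n) ℂ) * permMat π *
        ((Y⁻¹ : GL (Fin n) ℂ) : Matrix (Fin n) (Fin n) ℂ)) b.1 b.2}

/-- The matrix Schubert variety of `π`: the Zariski closure of `B_- π B_+` in the affine space of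
`n × n` matrices. -/
def matrixSchubert {n : ℕ} (π : Equiv.Perm (Fin n)) : Set (Fin n × Fin n → ℂ) :=
  zariskiClosure (borelOrbit π)

/-- `Y_π`: the projection of the matrix Schubert variety onto the entries inside `L(π)`. -/
def schubertY {n : ℕ} (π : Equiv.Perm (Fin n)) : Set (regionL π → ℂ) :=
  (fun M (b : regionL π) => M b.1) '' matrixSchubert π

/-! ### The torus and toric varieties -/

/-- `T^{2n}`: pairs of invertible diagonal `n × n` matrices, given by their diagonals. -/
abbrev TorusPair (n : ℕ) : Type := (Fin n → ℂˣ) × (Fin n → ℂˣ)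

/-- The pairs `(z I, z I)` of equal scalar matrices, which act trivially by `A M B⁻¹`. -/
def scalarPairs (n : ℕ) : Subgroup (TorusPair n) :=
  (({ toFun := fun z => (fun _ => z, fun _ => z)
      map_one' := rfl
      map_mul' := fun _ _ => rfl } : ℂˣ →* TorusPair n)).range

/-- `T^{2n-1}`: the quotient of `T^{2n}` by the pairs of equal scalar matrices. -/
abbrev Torus (n : ℕ) : Type := TorusPair n ⧸ scalarPairs n

/-- The character of `T^{2n}` by which it acts on the entry `(i, j)` in `(A, B) · M = A M B⁻¹`:
`(A, B) ↦ a_i b_j⁻¹`. -/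
def pairChar {n : ℕ} (b : Fin n × Fin n) : TorusPair n →* ℂˣ where
  toFun t := t.1 b.1 * (t.2 b.2)⁻¹
  map_one' := by simp
  map_mul' s t := by
    simp only [Prod.fst_mul, Prod.snd_mul, Pi.mul_apply, mul_inv]
    exact mul_mul_mul_comm (s.1 b.1) (t.1 b.1) (s.2 b.2)⁻¹ (t.2 b.2)⁻¹

/-- The induced character of `T^{2n-1}`. -/
def torusChar {n : ℕ} (b : Fin n × Fin n) : Torus n →* ℂˣ :=
  QuotientGroup.lift (scalarPairs n) (pairChar b) (by
    rintro _ ⟨z, rfl⟩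
    simp [pairChar])

/-- The action of `T^{2n-1}` on the affine space of the entries in a region `L` of the grid. -/
def torusAct {n : ℕ} {L : Set (Fin n × Fin n)} (t : Torus n) (y : L → ℂ) : L → ℂ :=
  fun b => (torusChar b.1 t : ℂ) * y b

/-- The subset `V` of the affine space of the entries in the region `L` is an (affine, normal)
toric variety with respect to the action of the torus `T^{2n-1}`: it is a closed, irreducible,
normal subvariety which is stable under the torus and has an open dense torus orbit. -/
structure IsToricVariety {n : ℕ} {L : Set (Fin n × Fin n)} (V : Set (L → ℂ)) : Prop where
  isClosed : IsZariskiClosed V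
  irreducible : (MvPolynomial.vanishingIdeal ℂ V).IsPrime
  normal : IsIntegrallyClosed (MvPolynomial L ℂ ⧸ MvPolynomial.vanishingIdeal ℂ V)
  stable : ∀ (t : Torus n), ∀ y ∈ V, torusAct t y ∈ V
  /-- Some orbit is dense in `V`, and is the complement in `V` of a closed set. -/
  exists_open_dense_orbit : ∃ p ∈ V,
    V ⊆ zariskiClosure (Set.range fun t : Torus n => torusAct t p) ∧
    ∃ Z : Set (L → ℂ), IsZariskiClosed Z ∧
      (Set.range fun t : Torus n => torusAct t p) = V \ Z

end MatrixSchubert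

namespace MatrixSchubert

open MvPolynomial

/-! ### Normality of retracts and of weight-zero subalgebras -/

/-! Every box of the diagram of `1π'` avoids row and column `0`, so the dominant piece is empty and
`L` is a lower set of boxes. As `π'` is dominant, the corner is the only `1` of the permutation
matrix weakly north-west of a box of `L`; hence a matrix in the Borel orbit has entries `a i * c j`
on `L`. Conversely, such a filling extended by zero is a product of triangular matrices around the
permutation matrix, possibly singular, and so a limit of the orbit. Thus `Y` is the closure of the
torus orbit of the all-ones point (`schubertY_oneCross`).

For normality, the monomials generated by `a_i b_j` with `(i, j) ∈ L` are the `a^α b^β` with `|α| =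
|β|` and, for every row `k`, `∑_{i ≥ k} α_i ≤ ∑_{(k, j) ∈ L} β_j`. Slack variables `t_k` turn the
inequalities into equations, and the coordinate ring becomes the weight-zero part of a polynomial
ring (`mem_range_ladderMap_iff`). This is a direct summand, hence integrally closed. The orbit is
open because it is the locus of the closure where no coordinate vanishes
(`mem_onesOrbit_of_ne_zero`). -/

/-- A subring of an integrally closed domain that is a direct summand is integrally closed. -/
theorem isIntegrallyClosed_of_retraction {A B : Type*} [CommRing A] [IsDomain A] [CommRing B]
    [IsDomain B] [IsIntegrallyClosed B] [Algebra A B]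
    (hinj : Function.Injective (algebraMap A B)) (ρ : B →ₗ[A] A)
    (hρ : ∀ a, ρ (algebraMap A B a) = a) : IsIntegrallyClosed A := by
  rw [isIntegrallyClosed_iff (FractionRing A)]
  intro x hx
  have hg : Function.Injective (algebraMap A (FractionRing B)) := by
    rw [IsScalarTower.algebraMap_eq A B (FractionRing B)]
    exact (IsFractionRing.injective B (FractionRing B)).comp hinj
  let φ : FractionRing A →+* FractionRing B := IsFractionRing.lift hg
  have hφ : ∀ a, φ (algebraMap A _ a) = algebraMap B (FractionRing B) (algebraMap A B a) := by
    intro a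
    rw [IsFractionRing.lift_algebraMap hg, ← IsScalarTower.algebraMap_apply]
  have hint : IsIntegral B (φ x) := by
    obtain ⟨p, hp, hpx⟩ := hx
    refine ⟨p.map (algebraMap A B), hp.map _, ?_⟩
    rw [Polynomial.eval₂_map]
    have := congrArg φ hpx
    rw [Polynomial.hom_eval₂, map_zero] at this
    rw [← this]
    congr 1
    ext a
    exact (hφ a).symm
  obtain ⟨f, hf⟩ := (isIntegrallyClosed_iff (FractionRing B)).mp ‹_› hint
  obtain ⟨g, h, hh, rfl⟩ := IsFractionRing.div_surjective (A := A) x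
  have hh0 : h ≠ 0 := nonZeroDivisors.ne_zero hh
  have hh1 : algebraMap A (FractionRing A) h ≠ 0 := by
    simpa using hh0
  have key : algebraMap A B h * f = algebraMap A B g := by
    apply IsFractionRing.injective B (FractionRing B)
    rw [map_mul, hf, ← hφ, ← hφ, ← map_mul, mul_div_cancel₀ _ hh1]
  -- Applying the `A`-linear `ρ` to `h * f = g` gives `h * ρ f = g`, so the fraction `g / h` lies in
  -- `A`.
  refine ⟨ρ f, ?_⟩
  rw [eq_div_iff hh1, ← map_mul, mul_comm]
  congr 1
  have := congrArg ρ key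
  rwa [hρ, ← Algebra.smul_def, map_smul, smul_eq_mul] at this

/-- A subalgebra of a polynomial ring spanned by the monomials of weight zero, for weights in a
group, is integrally closed. -/
theorem isIntegrallyClosed_of_weight_zero {K σ G : Type*} [Field K] [AddCommGroup G]
    (w : σ → G) (A : Subalgebra K (MvPolynomial σ K))
    (hA : ∀ p, p ∈ A ↔ IsWeightedHomogeneous w p 0) : IsIntegrallyClosed A := by
  classical
  let _ := weightedGradedAlgebra K w
  have hc : ∀ p : MvPolynomial σ K, weightedHomogeneousComponent w 0 p ∈ A := fun p =>
    (hA _).2 (weightedHomogeneousComponent_isWeightedHomogeneous 0 p)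
  have hmul : ∀ a p : MvPolynomial σ K, a ∈ A → weightedHomogeneousComponent w 0 (a * p) =
      a * weightedHomogeneousComponent w 0 p := by
    intro a p ha
    have := DirectSum.coe_decompose_mul_add_of_left_mem (weightedHomogeneousSubmodule K w)
      (i := 0) (j := 0) (b := p) ((mem_weightedHomogeneousSubmodule K w 0 a).2 ((hA a).1 ha))
    rw [add_zero] at this
    rw [← weightedDecomposition.decompose'_apply, ← weightedDecomposition.decompose'_apply]
    exact this
  -- The projection to the weight-zero component is `A`-linear because multiplication by weight zero
  -- preserves weights.
  let ρ : MvPolynomial σ K →ₗ[A] A :=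
    { toFun p := ⟨weightedHomogeneousComponent w 0 p, hc p⟩
      map_add' p q := by ext1; simp
      map_smul' a p := by
        ext1
        simpa [Subalgebra.smul_def] using hmul a p a.2 }
  refine isIntegrallyClosed_of_retraction (B := MvPolynomial σ K) Subtype.val_injective ρ ?_
  intro a
  ext1
  exact weightedHomogeneousComponent_eq_self ((hA _).1 a.2)

/-! ### The Zariski closure -/

theorem vanishingIdeal_zariskiClosure {σ : Type*} (S : Set (σ → ℂ)) :
    vanishingIdeal ℂ (zariskiClosure S) = vanishingIdeal ℂ S :=
  le_antisymm (vanishingIdeal_anti_mono (zeroLocus_vanishingIdeal_le S))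
    (le_vanishingIdeal_zeroLocus _)

theorem isZariskiClosed_zariskiClosure {σ : Type*} (S : Set (σ → ℂ)) :
    IsZariskiClosed (zariskiClosure S) := by
  unfold IsZariskiClosed
  nth_rw 1 [zariskiClosure]
  rw [vanishingIdeal_zariskiClosure]
  rfl

theorem isZariskiClosed_zeros {σ : Type*} (p : MvPolynomial σ ℂ) :
    IsZariskiClosed {x : σ → ℂ | aeval x p = 0} :=
  Set.Subset.antisymm (fun _ hx => hx p fun _ hy => hy) (zeroLocus_vanishingIdeal_le _)

/-- Polynomial maps are compatible with Zariski closures. -/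
theorem polynomialMap_mem_zariskiClosure {σ τ : Type*} (g : τ → MvPolynomial σ ℂ)
    {S : Set (σ → ℂ)} {T : Set (τ → ℂ)}
    (h : ∀ x ∈ S, (fun j => aeval x (g j)) ∈ zariskiClosure T) {x : σ → ℂ}
    (hx : x ∈ zariskiClosure S) : (fun j => aeval x (g j)) ∈ zariskiClosure T := by
  intro p hp
  have hcomp : ∀ y : σ → ℂ, aeval y (aeval g p) = aeval (fun j => aeval y (g j)) p := by
    intro y
    rw [← AlgHom.comp_apply, comp_aeval]
  rw [← hcomp]
  refine hx _ fun y hy => ?_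
  rw [hcomp]
  exact h y hy p hp

/-! ### The monomial parametrization attached to a lower set of boxes -/

section Ladder

variable {n : ℕ} (L : Set (Fin n × Fin n))

/-- Variables `a_i` (rows), `b_j` (columns), and slack variables `t_k` (rows). -/
abbrev LadderVar (n : ℕ) : Type := Fin n ⊕ Fin n ⊕ Fin n

open Classical in
/-- The rows `k > i` with `(k, j) ∈ L`. -/
noncomputable def rowsBelow (b : Fin n × Fin n) : Finset (Fin n) :=
  Finset.univ.filter fun k => b.1 < k ∧ (k, b.2) ∈ L

/-- The exponent of `a_i b_j ∏ t_k`, the product over the rows `k > i` with `(k, j) ∈ L`. -/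
noncomputable def ladderExp (b : Fin n × Fin n) : LadderVar n →₀ ℕ :=
  Finsupp.single (Sum.inl b.1) 1 + (Finsupp.single (Sum.inr (Sum.inl b.2)) 1 +
    ∑ k ∈ rowsBelow L b, Finsupp.single (Sum.inr (Sum.inr k)) 1)

/-- The algebra map sending the coordinate of a box to its ladder monomial. -/
noncomputable def ladderMap : MvPolynomial L ℂ →ₐ[ℂ] MvPolynomial (LadderVar n) ℂ :=
  aeval fun b : L => monomial (ladderExp L b.1) 1

theorem monomial_ladderExp (b : Fin n × Fin n) :
    (monomial (ladderExp L b) 1 : MvPolynomial (LadderVar n) ℂ) =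
      X (Sum.inl b.1) * (X (Sum.inr (Sum.inl b.2)) *
        ∏ k ∈ rowsBelow L b, X (Sum.inr (Sum.inr k))) := by
  rw [ladderExp, ← one_mul (1 : ℂ), ← monomial_mul, ← one_mul (1 : ℂ), ← monomial_mul,
    monomial_sum_one, one_mul]
  rfl

theorem aeval_ladderMap (x : LadderVar n → ℂ) (p : MvPolynomial L ℂ) :
    aeval x (ladderMap L p) = aeval (fun b : L => x (Sum.inl b.1.1) *
      (x (Sum.inr (Sum.inl b.1.2)) * ∏ k ∈ rowsBelow L b.1, x (Sum.inr (Sum.inr k)))) p := by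
  rw [ladderMap, ← AlgHom.comp_apply, comp_aeval]
  simp [monomial_ladderExp]

open Classical in
/-- The weight: `|α| - |β|` and the slack equations. -/
noncomputable def ladderWeight : LadderVar n → ℤ × (Fin n → ℤ) :=
  Sum.elim (fun i => (1, fun k => if k ≤ i then 1 else 0))
    (Sum.elim (fun j => (-1, fun k => if (k, j) ∈ L then -1 else 0))
      (fun k => (0, Pi.single k 1)))

/-- For `k ≤ i` the row term `1` cancels the column term `-1`, since a lower set containing `(i, j)`
contains `(k, j)`; for `k > i` the slack variable cancels the column term. -/
theorem weight_ladderExp (hL : IsLowerSet L) {b : Fin n × Fin n} (hb : b ∈ L) :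
    Finsupp.weight (ladderWeight L) (ladderExp L b) = 0 := by
  classical
  simp only [ladderExp, map_add, map_sum, Finsupp.weight_single, one_smul]
  ext k
  · simp [ladderWeight, Prod.fst_sum]
  · simp only [ladderWeight, Prod.snd_add, Prod.snd_sum, Sum.elim_inl, Sum.elim_inr, Pi.add_apply,
      Finset.sum_apply, Finset.sum_pi_single, Prod.snd_zero, Pi.zero_apply, rowsBelow,
      Finset.mem_filter, Finset.mem_univ, true_and]
    by_cases h : k ≤ b.1
    · have : (k, b.2) ∈ L := hL (show (k, b.2) ≤ b from ⟨h, le_rfl⟩) hb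
      simp [h, this, not_lt.2 h]
    · simp [h, not_le.1 h]
      split_ifs <;> simp

theorem weight_ladderWeight_fst (m : LadderVar n →₀ ℕ) :
    (Finsupp.weight (ladderWeight L) m).1 =
      (∑ i, (m (Sum.inl i) : ℤ)) - ∑ j, (m (Sum.inr (Sum.inl j)) : ℤ) := by
  rw [Finsupp.weight_eq_sum, Prod.fst_sum]
  simp [ladderWeight, sub_eq_add_neg]

open Classical in
theorem weight_ladderWeight_snd (m : LadderVar n →₀ ℕ) (k : Fin n) :
    (Finsupp.weight (ladderWeight L) m).2 k =
      (∑ i, if k ≤ i then (m (Sum.inl i) : ℤ) else 0) -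
        (∑ j, if (k, j) ∈ L then (m (Sum.inr (Sum.inl j)) : ℤ) else 0) +
        m (Sum.inr (Sum.inr k)) := by
  rw [Finsupp.weight_eq_sum, Prod.snd_sum, Finset.sum_apply]
  simp only [Fintype.sum_sum_type, ladderWeight, Sum.elim_inl, Sum.elim_inr, Prod.smul_snd,
    Pi.smul_apply, Pi.single_apply]
  rw [sub_eq_add_neg, ← Finset.sum_neg_distrib, add_assoc]
  refine congrArg₂ _ ?_ (congrArg₂ _ ?_ ?_)
  · simp
  · exact Finset.sum_congr rfl fun j _ => by split_ifs <;> simp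
  · simp

/-- A nonzero exponent of weight zero is divisible by a ladder monomial. -/
theorem exists_ladderExp_le {m : LadderVar n →₀ ℕ}
    (hm : Finsupp.weight (ladderWeight L) m = 0) (h0 : m ≠ 0) :
    ∃ b ∈ L, ladderExp L b ≤ m := by
  classical
  have h1 := weight_ladderWeight_fst L m
  have h2 := weight_ladderWeight_snd L m
  simp only [hm, Prod.fst_zero, Prod.snd_zero, Pi.zero_apply] at h1 h2
  have hrow : ∃ i, m (Sum.inl i) ≠ 0 := by
    by_contra! hα
    simp only [hα, Nat.cast_zero, Finset.sum_const_zero, ite_self, zero_sub] at h1 h2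
    have hβ : ∀ j, m (Sum.inr (Sum.inl j)) = 0 := by
      have h3 : ∑ j, m (Sum.inr (Sum.inl j)) = 0 := by
        zify; linarith
      intro j
      exact (Finset.sum_eq_zero_iff.1 h3) j (Finset.mem_univ j)
    simp only [hβ, Nat.cast_zero, ite_self, Finset.sum_const_zero, neg_zero, zero_add] at h2
    apply h0
    ext (i | j | k)
    · exact hα i
    · exact hβ j
    · exact_mod_cast (h2 k).symm
  -- Taking the last occupied row makes the row sums vanish in all equations with `k > i`.
  obtain ⟨i, hi, hmax⟩ : ∃ i, m (Sum.inl i) ≠ 0 ∧ ∀ i', i < i' → m (Sum.inl i') = 0 := by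
    have hne : (Finset.univ.filter fun i => m (Sum.inl i) ≠ 0).Nonempty := by
      obtain ⟨i, hi⟩ := hrow
      exact ⟨i, by simpa using hi⟩
    refine ⟨_, (Finset.mem_filter.1 (Finset.max'_mem _ hne)).2, fun i' hi' => ?_⟩
    by_contra h
    exact absurd (Finset.le_max' _ i' (by simpa using h)) (not_le.2 hi')
  -- The equation for row `i` has a positive row sum, which only a column meeting `L` in row `i` can
  -- balance.
  obtain ⟨j, hj, hjm⟩ : ∃ j, (i, j) ∈ L ∧ m (Sum.inr (Sum.inl j)) ≠ 0 := by
    by_contra! h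
    have h3 := h2 i
    rw [Finset.sum_eq_zero (f := fun j => if (i, j) ∈ L then (m (Sum.inr (Sum.inl j)) : ℤ) else 0)
      (fun j _ => by split_ifs with hij; · simp [h j hij]
                     · rfl)] at h3
    have h4 : (m (Sum.inl i) : ℤ) ≤ ∑ i', if i ≤ i' then (m (Sum.inl i') : ℤ) else 0 := by
      have := Finset.single_le_sum (s := Finset.univ)
        (f := fun i' => if i ≤ i' then (m (Sum.inl i') : ℤ) else 0)
        (fun i' _ => by positivity) (Finset.mem_univ i)
      simpa using this
    omega
  refine ⟨(i, j), hj, ?_⟩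
  -- For `k > i` the exponent of `t_k` equals the whole column sum of row `k`, which includes that
  -- of `b_j`.
  have hslack : ∀ k, i < k → (k, j) ∈ L → 1 ≤ m (Sum.inr (Sum.inr k)) := by
    intro k hk hkj
    have h3 := h2 k
    rw [Finset.sum_eq_zero (f := fun i' => if k ≤ i' then (m (Sum.inl i') : ℤ) else 0)
      (fun i' _ => by
        split_ifs with h
        · simp [hmax i' (hk.trans_le h)]
        · rfl)] at h3
    have h4 : (m (Sum.inr (Sum.inl j)) : ℤ) ≤
        ∑ j', if (k, j') ∈ L then (m (Sum.inr (Sum.inl j')) : ℤ) else 0 := by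
      have := Finset.single_le_sum (s := Finset.univ)
        (f := fun j' => if (k, j') ∈ L then (m (Sum.inr (Sum.inl j')) : ℤ) else 0)
        (fun j' _ => by positivity) (Finset.mem_univ j)
      simpa [hkj] using this
    omega
  intro v
  rcases v with i' | j' | k
  · by_cases h : i = i'
    · subst h
      simpa [ladderExp, Finsupp.finsetSum_apply] using Nat.one_le_iff_ne_zero.2 hi
    · simp [ladderExp, h]
  · by_cases h : j = j'
    · subst h
      simpa [ladderExp, Finsupp.finsetSum_apply] using Nat.one_le_iff_ne_zero.2 hjm
    · simp [ladderExp, h]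
  · by_cases h : i < k ∧ (k, j) ∈ L
    · simpa [ladderExp, Finsupp.finsetSum_apply, Finsupp.single_apply, rowsBelow, h]
        using hslack k h.1 h.2
    · simp [ladderExp, Finsupp.single_apply, rowsBelow, h]

/-- Dividing by a ladder monomial keeps the weight zero and lowers the degree, which drives an
induction. -/
theorem monomial_mem_range_ladderMap (hL : IsLowerSet L) (N : ℕ) :
    ∀ m : LadderVar n →₀ ℕ, m.degree = N → Finsupp.weight (ladderWeight L) m = 0 →
      (monomial m 1 : MvPolynomial (LadderVar n) ℂ) ∈ (ladderMap L).range := by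
  induction N using Nat.strong_induction_on with
  | _ N ih =>
    intro m hN hm
    by_cases h0 : m = 0
    · subst h0
      exact one_mem _
    obtain ⟨b, hb, hle⟩ := exists_ladderExp_le L hm h0
    obtain ⟨m', rfl⟩ := exists_add_of_le hle
    rw [map_add, weight_ladderExp L hL hb, zero_add] at hm
    have hdeg : m'.degree < N := by
      rw [← hN, map_add, ladderExp, map_add, Finsupp.degree_single]
      omega
    have hb' : (monomial (ladderExp L b) 1 : MvPolynomial (LadderVar n) ℂ) ∈
        (ladderMap L).range := ⟨X ⟨b, hb⟩, by simp [ladderMap]⟩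
    have := mul_mem hb' (ih _ hdeg m' rfl hm)
    simpa [monomial_mul] using this

theorem mem_range_ladderMap_iff (hL : IsLowerSet L) (p : MvPolynomial (LadderVar n) ℂ) :
    p ∈ (ladderMap L).range ↔ IsWeightedHomogeneous (ladderWeight L) p 0 := by
  constructor
  · rintro ⟨q, rfl⟩
    induction q using MvPolynomial.induction_on with
    | C a => simpa [ladderMap] using isWeightedHomogeneous_C (ladderWeight L) a
    | add p q hp hq => simpa using hp.add hq
    | mul_X p b hp =>
      have := hp.mul (isWeightedHomogeneous_monomial (R := ℂ) (ladderWeight L) (ladderExp L b.1) 1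
        (weight_ladderExp L hL b.2))
      simpa [ladderMap] using this
  · intro hp
    rw [p.as_sum]
    refine sum_mem fun m hm => ?_
    have h := monomial_mem_range_ladderMap L hL _ m rfl (hp (mem_support_iff.1 hm))
    have h' := Subalgebra.smul_mem _ h (coeff m p)
    rwa [smul_monomial, smul_eq_mul, mul_one] at h'

theorem isIntegrallyClosed_quotient_ker_ladderMap (hL : IsLowerSet L) :
    IsIntegrallyClosed (MvPolynomial L ℂ ⧸ RingHom.ker (ladderMap L)) := by
  have := isIntegrallyClosed_of_weight_zero (ladderWeight L) (ladderMap L).range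
    (mem_range_ladderMap_iff L hL)
  exact IsIntegrallyClosed.of_equiv
    (Ideal.quotientKerAlgEquivOfSurjective (ladderMap L).rangeRestrict_surjective
      |>.toRingEquiv.symm.trans (Ideal.quotEquivOfEq (AlgHom.ker_rangeRestrict _)))

end Ladder

/-! ### The torus orbit of the all-ones point -/

section Orbit

variable {n : ℕ} (L : Set (Fin n × Fin n))

/-- The torus orbit of the point all of whose coordinates are `1`. -/
def onesOrbit : Set (L → ℂ) :=
  Set.range fun t : Torus n => torusAct t (fun _ : L => (1 : ℂ))

theorem mem_onesOrbit_iff (y : L → ℂ) :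
    y ∈ onesOrbit L ↔ ∃ a c : Fin n → ℂ, (∀ i, a i ≠ 0) ∧ (∀ j, c j ≠ 0) ∧
      ∀ b : L, y b = a b.1.1 * c b.1.2 := by
  constructor
  · rintro ⟨t, rfl⟩
    induction t using QuotientGroup.induction_on with
    | H t =>
      refine ⟨fun i => (t.1 i : ℂ), fun j => ((t.2 j)⁻¹ : ℂˣ), fun i => (t.1 i).ne_zero,
        fun j => Units.ne_zero _, fun b => ?_⟩
      simp [torusAct, torusChar, pairChar]
  · rintro ⟨a, c, ha, hc, h⟩
    refine ⟨QuotientGroup.mk (fun i => Units.mk0 (a i) (ha i),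
      fun j => (Units.mk0 (c j) (hc j))⁻¹), ?_⟩
    funext b
    simp [torusAct, torusChar, pairChar, h]

/-- The slack variables add no new points: where all variables are nonzero they are absorbed by
rescaling the `a_i` and `b_j`, and setting them to `1` recovers the orbit. -/
theorem vanishingIdeal_onesOrbit (hL : IsLowerSet L) :
    vanishingIdeal ℂ (onesOrbit L) = RingHom.ker (ladderMap L) := by
  classical
  ext p
  rw [mem_vanishingIdeal_iff, RingHom.mem_ker]
  constructor
  · intro h
    refine funext_set (fun _ => {0}ᶜ) (fun _ => (Set.finite_singleton _).infinite_compl)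
      fun x hx => ?_
    replace hx : ∀ v, x v ≠ 0 := fun v => hx v (Set.mem_univ v)
    rw [map_zero, ← coe_aeval_eq_eval, RingHom.coe_coe]
    rw [aeval_ladderMap]
    apply h
    rw [mem_onesOrbit_iff]
    -- The rows `k` with `(k, j) ∈ L` are those with `k ≤ i` together with `rowsBelow`, so the
    -- quotient of the two products is the slack factor of the box.
    refine ⟨fun i => x (Sum.inl i) * (∏ k with k ≤ i, x (Sum.inr (Sum.inr k)))⁻¹,
      fun j => x (Sum.inr (Sum.inl j)) * ∏ k with (k, j) ∈ L, x (Sum.inr (Sum.inr k)),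
      fun i => mul_ne_zero (hx _) (inv_ne_zero (Finset.prod_ne_zero_iff.2 fun k _ => hx _)),
      fun j => mul_ne_zero (hx _) (Finset.prod_ne_zero_iff.2 fun k _ => hx _), fun b => ?_⟩
    have hsplit : (∏ k with (k, b.1.2) ∈ L, x (Sum.inr (Sum.inr k))) =
        (∏ k with k ≤ b.1.1, x (Sum.inr (Sum.inr k))) *
          ∏ k ∈ rowsBelow L b.1, x (Sum.inr (Sum.inr k)) := by
      rw [← Finset.prod_union]
      · congr 1
        ext k
        simp only [rowsBelow, Finset.mem_filter, Finset.mem_univ, true_and, Finset.mem_union]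
        constructor
        · intro hk
          rcases le_or_gt k b.1.1 with h1 | h1
          · exact Or.inl h1
          · exact Or.inr ⟨h1, hk⟩
        · rintro (h1 | h1)
          · exact hL (show (k, b.1.2) ≤ b.1 from ⟨h1, le_rfl⟩) b.2
          · exact h1.2
      · rw [Finset.disjoint_left]
        intro k hk hk'
        simp only [rowsBelow, Finset.mem_filter, Finset.mem_univ, true_and] at hk hk'
        exact absurd hk'.1 (not_lt.2 hk)
    have hne : (∏ k with k ≤ b.1.1, x (Sum.inr (Sum.inr k))) ≠ 0 :=
      Finset.prod_ne_zero_iff.2 fun k _ => hx _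
    dsimp only
    rw [hsplit]
    field_simp
  · intro h y hy
    obtain ⟨a, c, -, -, hac⟩ := (mem_onesOrbit_iff L y).1 hy
    have := aeval_ladderMap L (Sum.elim a (Sum.elim c fun _ => 1)) p
    rw [h, map_zero] at this
    rw [this]
    congr 2
    funext b
    simp [hac]

/-- Here `a` and `c` may vanish somewhere, as happens for entries of triangular matrices. -/
theorem rankOne_mem_zariskiClosure_onesOrbit (hL : IsLowerSet L) (a c : Fin n → ℂ) :
    (fun b : L => a b.1.1 * c b.1.2) ∈ zariskiClosure (onesOrbit L) := by
  intro p hp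
  rw [vanishingIdeal_onesOrbit L hL, RingHom.mem_ker] at hp
  have := aeval_ladderMap L (Sum.elim a (Sum.elim c fun _ => 1)) p
  rw [hp, map_zero] at this
  simpa using this.symm

theorem torusAct_mem_onesOrbit (t : Torus n) {y : L → ℂ} (hy : y ∈ onesOrbit L) :
    torusAct t y ∈ onesOrbit L := by
  obtain ⟨s, rfl⟩ := hy
  exact ⟨t * s, by funext b; simp [torusAct]⟩

end Orbit

/-- Off the coordinate hyperplanes, the closure of the orbit is the orbit. -/
theorem mem_onesOrbit_of_ne_zero {n : ℕ} {L : Set (Fin (n + 1) × Fin (n + 1))}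
    (hL : IsLowerSet L) {y : L → ℂ} (hy : y ∈ zariskiClosure (onesOrbit L))
    (h0 : ∀ b, y b ≠ 0) : y ∈ onesOrbit L := by
  classical
  have hle : ∀ b ∈ L, (b.1, 0) ∈ L ∧ (0, b.2) ∈ L ∧ ((0, 0) : Fin (n + 1) × Fin (n + 1)) ∈ L :=
    fun b hb => ⟨hL (show (b.1, 0) ≤ b from ⟨le_rfl, Fin.zero_le _⟩) hb,
      hL (show (0, b.2) ≤ b from ⟨Fin.zero_le _, le_rfl⟩) hb,
      hL (show (0, 0) ≤ b from ⟨Fin.zero_le _, Fin.zero_le _⟩) hb⟩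
  -- The 2 × 2 minors through the corner box vanish on the orbit, hence on its closure.
  have hminor : ∀ b : L, y b * y ⟨_, (hle b b.2).2.2⟩ =
      y ⟨_, (hle b b.2).1⟩ * y ⟨_, (hle b b.2).2.1⟩ := by
    intro b
    have := hy (X b * X ⟨_, (hle b b.2).2.2⟩ - X ⟨_, (hle b b.2).1⟩ * X ⟨_, (hle b b.2).2.1⟩) (by
      intro z hz
      obtain ⟨a, c, -, -, hac⟩ := (mem_onesOrbit_iff L z).1 hz
      simp only [map_sub, map_mul, aeval_X, hac]
      ring)
    simpa [sub_eq_zero] using this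
  rw [mem_onesOrbit_iff]
  -- The factors are read off column `0` and row `0`, the latter divided by the corner; the default
  -- `1` serves rows and columns that miss `L`.
  refine ⟨fun i => if h : (i, 0) ∈ L then y ⟨_, h⟩ else 1,
    fun j => if h : (0, j) ∈ L then y ⟨_, h⟩ * (y ⟨_, (hle _ h).2.2⟩)⁻¹ else 1, ?_, ?_, ?_⟩
  · intro i
    dsimp only
    split_ifs with h
    · exact h0 _
    · exact one_ne_zero
  · intro j
    dsimp only
    split_ifs with h
    · exact mul_ne_zero (h0 _) (inv_ne_zero (h0 _))
    · exact one_ne_zero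
  · intro b
    have h00 := h0 ⟨_, (hle b b.2).2.2⟩
    simp only [(hle b b.2).1, (hle b b.2).2.1, dif_pos]
    rw [← mul_assoc, ← hminor b, mul_inv_cancel_right₀ h00]

/-- For a lower set of boxes, the closure of the torus orbit of the all-ones point is toric. -/
theorem isToricVariety_zariskiClosure_onesOrbit {n : ℕ} {L : Set (Fin (n + 1) × Fin (n + 1))}
    (hL : IsLowerSet L) : IsToricVariety (zariskiClosure (onesOrbit L)) where
  isClosed := isZariskiClosed_zariskiClosure _
  irreducible := by
    rw [vanishingIdeal_zariskiClosure, vanishingIdeal_onesOrbit L hL]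
    exact RingHom.ker_isPrime _
  normal := by
    rw [vanishingIdeal_zariskiClosure, vanishingIdeal_onesOrbit L hL]
    exact isIntegrallyClosed_quotient_ker_ladderMap L hL
  stable t y hy := by
    have := polynomialMap_mem_zariskiClosure (S := onesOrbit L) (T := onesOrbit L)
      (fun b : L => C (torusChar b.1 t : ℂ) * X b) (fun x hx => by
        simp only [map_mul, aeval_C, aeval_X]
        exact zeroLocus_vanishingIdeal_le _ (torusAct_mem_onesOrbit L t hx)) hy
    simp only [map_mul, aeval_C, aeval_X] at this
    exact this
  exists_open_dense_orbit := by
    classical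
    refine ⟨fun _ => 1, zeroLocus_vanishingIdeal_le _ ⟨1, by funext b; simp [torusAct]⟩,
      Set.Subset.rfl, _, isZariskiClosed_zeros (∏ b : L, X b), ?_⟩
    ext y
    simp only [Set.mem_sdiff, Set.mem_ofPred_eq, map_prod, aeval_X, Finset.prod_eq_zero_iff,
      Finset.mem_univ, true_and, not_exists]
    constructor
    · intro hy
      refine ⟨zeroLocus_vanishingIdeal_le _ hy, fun b => ?_⟩
      obtain ⟨a, c, ha, hc, hac⟩ := (mem_onesOrbit_iff L y).1 hy
      rw [hac]
      exact mul_ne_zero (ha _) (hc _)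
    · rintro ⟨hy, h0⟩
      exact mem_onesOrbit_of_ne_zero hL hy h0

/-! ### Triangular matrices and the matrix Schubert variety -/

theorem mul_permMat_mul_apply {n : ℕ} (π : Equiv.Perm (Fin n)) (A B : Matrix (Fin n) (Fin n) ℂ)
    (i j : Fin n) : (A * permMat π * B) i j = ∑ l, A i (π l) * B l j := by
  simp [Matrix.mul_apply, permMat]

/-- Products `A P_π B` with `A` lower and `B` upper triangular, possibly singular, lie in the
matrix Schubert variety. -/
theorem mul_permMat_mul_mem_matrixSchubert {n : ℕ} (π : Equiv.Perm (Fin n))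
    {A B : Matrix (Fin n) (Fin n) ℂ} (hA : ∀ i j, i < j → A i j = 0)
    (hB : ∀ i j, j < i → B i j = 0) :
    (fun b : Fin n × Fin n => (A * permMat π * B) b.1 b.2) ∈ matrixSchubert π := by
  intro p hp
  -- On the line `(A + t) P (B + t)` the polynomial `p` vanishes whenever both factors are
  -- invertible, that is for all but finitely many `t`; hence also at `t = 0`.
  let g : Fin n × Fin n → Polynomial ℂ := fun b => ∑ l,
    (Polynomial.C (A b.1 (π l)) + Polynomial.C ((1 : Matrix (Fin n) (Fin n) ℂ) b.1 (π l)) *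
      Polynomial.X) *
    (Polynomial.C (B l b.2) + Polynomial.C ((1 : Matrix (Fin n) (Fin n) ℂ) l b.2) * Polynomial.X)
  have hg : ∀ t : ℂ, Polynomial.aeval t (aeval g p) = aeval (fun b : Fin n × Fin n =>
      ((A + t • 1) * permMat π * (B + t • 1)) b.1 b.2) p := by
    intro t
    rw [← AlgHom.comp_apply, comp_aeval]
    congr 2
    funext b
    simp only [g, mul_permMat_mul_apply, map_sum, map_mul, map_add, Polynomial.aeval_C,
      Polynomial.aeval_X, Matrix.add_apply, Matrix.smul_apply, smul_eq_mul,
      Algebra.algebraMap_self, RingHom.id_apply]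
    exact Finset.sum_congr rfl fun l _ => by ring
  have hzero : (aeval g p : Polynomial ℂ) = 0 := by
    let s : Set ℂ := (Set.range fun i => -A i i) ∪ (Set.range fun i => -B i i)
    have hs : s.Finite := (Set.finite_range _).union (Set.finite_range _)
    refine Polynomial.eq_zero_of_infinite_isRoot _ (hs.infinite_compl.mono fun t ht => ?_)
    simp only [s, Set.mem_compl_iff, Set.mem_union, Set.mem_range, not_or, not_exists] at ht
    change Polynomial.eval t _ = 0
    rw [← Polynomial.coe_aeval_eq_eval, hg t]
    have hAt : ∀ i j, i < j → (A + t • 1) i j = 0 := fun i j hij => by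
      simp [hA i j hij, hij.ne]
    have hBt : ∀ i j, j < i → (B + t • 1) i j = 0 := fun i j hij => by
      simp [hB i j hij, hij.ne']
    have hdA : (A + t • 1).det ≠ 0 := by
      rw [Matrix.det_of_isLowerTriangular _ (fun i j hij => hAt i j hij)]
      refine Finset.prod_ne_zero_iff.2 fun i _ h => ht.1 i ?_
      simp only [Matrix.add_apply, Matrix.smul_apply, Matrix.one_apply_eq, smul_eq_mul,
        mul_one] at h
      linear_combination -h
    have hdB : (B + t • 1).det ≠ 0 := by
      rw [Matrix.det_of_isUpperTriangular (fun i j hij => hBt i j hij)]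
      refine Finset.prod_ne_zero_iff.2 fun i _ h => ht.2 i ?_
      simp only [Matrix.add_apply, Matrix.smul_apply, Matrix.one_apply_eq, smul_eq_mul,
        mul_one] at h
      linear_combination -h
    refine hp _ ⟨Matrix.GeneralLinearGroup.mkOfDetNeZero _ hdA,
      (Matrix.GeneralLinearGroup.mkOfDetNeZero _ hdB)⁻¹, hAt, ?_, fun b => ?_⟩
    · have : Invertible (B + t • 1) := Matrix.invertibleOfIsUnitDet _ (isUnit_iff_ne_zero.2 hdB)
      have h := Matrix.blockTriangular_inv_of_blockTriangular (M := B + t • 1) (b := id)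
        (fun i j hij => hBt i j hij)
      intro i j hij
      rw [Matrix.coe_units_inv]
      exact h hij
    · rw [inv_inv]
      rfl
  have := hg 0
  rw [hzero, map_zero] at this
  simpa using this.symm

/-! ### The region of `1π'` for dominant `π'` -/

section OneCross

variable {n : ℕ} {π' : Equiv.Perm (Fin n)}

@[simp]
theorem oneCross_zero : oneCross π' 0 = 0 := by simp [oneCross]

@[simp]
theorem oneCross_succ (i : Fin n) : oneCross π' i.succ = (π' i).succ := by simp [oneCross]

theorem mem_diagram_iff (π : Equiv.Perm (Fin n)) (r c : Fin n) :
    (r, c) ∈ diagram π ↔ r < π c ∧ c < π.symm r := by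
  constructor
  · rintro ⟨i, j, hij, hπ, h⟩
    obtain ⟨rfl, rfl⟩ := Prod.mk.inj h
    exact ⟨hπ, by simpa using hij⟩
  · rintro ⟨h1, h2⟩
    exact ⟨c, π.symm r, h2, by simpa using h1, by simp⟩

theorem mem_diagram_oneCross_iff (r c : Fin (n + 1)) :
    (r, c) ∈ diagram (oneCross π') ↔
      ∃ r' c', r = Fin.succ r' ∧ c = Fin.succ c' ∧ (r', c') ∈ diagram π' := by
  constructor
  · rintro ⟨i, j, hij, hπ, h⟩
    obtain ⟨rfl, rfl⟩ := Prod.mk.inj h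
    induction j using Fin.cases with
    | zero => exact absurd hij (by simp)
    | succ j =>
      induction c using Fin.cases with
      | zero => simp at hπ
      | succ i =>
        exact ⟨π' j, i, by simp, rfl, i, j, by simpa using hij, by simpa using hπ, rfl⟩
  · rintro ⟨r', c', rfl, rfl, i, j, hij, hπ, h⟩
    obtain ⟨rfl, rfl⟩ := Prod.mk.inj h
    exact ⟨c'.succ, j.succ, by simpa using hij, by simpa using hπ, by simp⟩

theorem regionL_oneCross : regionL (oneCross π') = northWest (oneCross π') := by
  rw [regionL, sdiff_eq_left, Set.disjoint_left]
  rintro b - ⟨c, hc, h1, -⟩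
  obtain ⟨r', c', hr, -⟩ := (mem_diagram_oneCross_iff c.1 c.2).1 hc
  rw [hr] at h1
  simp at h1

theorem isLowerSet_regionL_oneCross : IsLowerSet (regionL (oneCross π')) := by
  rw [regionL_oneCross]
  rintro b b' hb ⟨c, hc, h1, h2⟩
  exact ⟨c, hc, hb.1.trans h1, hb.2.trans h2⟩

theorem succ_mem_regionL_oneCross_iff (hπ' : IsDominant π') (i j : Fin n) :
    (i.succ, j.succ) ∈ regionL (oneCross π') ↔ (i, j) ∈ diagram π' := by
  rw [regionL_oneCross]
  constructor
  · rintro ⟨⟨r, c⟩, hc, h1, h2⟩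
    obtain ⟨r', c', rfl, rfl, h⟩ := (mem_diagram_oneCross_iff _ _).1 hc
    exact hπ' (show (i, j) ≤ (r', c') from
      ⟨Fin.succ_le_succ_iff.1 h1, Fin.succ_le_succ_iff.1 h2⟩) h
  · intro h
    exact ⟨_, (mem_diagram_oneCross_iff _ _).2 ⟨i, j, rfl, rfl, h⟩, le_rfl, le_rfl⟩

/-- Only the first `1` of the permutation matrix lies north-west of a box of the region. -/
theorem eq_zero_of_mem_regionL (hπ' : IsDominant π') {i j l : Fin (n + 1)}
    (h : (i, j) ∈ regionL (oneCross π')) (hl : l ≤ j) (hi : oneCross π' l ≤ i) : l = 0 := by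
  induction l using Fin.cases with
  | zero => rfl
  | succ l =>
    exfalso
    rw [oneCross_succ] at hi
    have h1 := isLowerSet_regionL_oneCross
      (show ((π' l).succ, l.succ) ≤ (i, j) from ⟨hi, hl⟩) h
    rw [succ_mem_regionL_oneCross_iff hπ', mem_diagram_iff] at h1
    exact lt_irrefl _ h1.1

/-- Row `i` of the region `L` ends just before column `l`, which meets `L`. -/
def RowEndsAt (L : Set (Fin (n + 1) × Fin (n + 1))) (i l : Fin (n + 1)) : Prop :=
  (i, l) ∉ L ∧ (0, l) ∈ L ∧ ∀ k < l, (i, k) ∈ L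

/-- This makes `indicatorLower` lower triangular. Were the `1` of column `l` below row `i`, the `1`
of row `i` would lie left of column `l`, hence in `L`; but below the top row `L` is the diagram,
which contains no `1`. -/
theorem RowEndsAt.oneCross_le (hπ' : IsDominant π') {i l : Fin (n + 1)}
    (h : RowEndsAt (regionL (oneCross π')) i l) : oneCross π' l ≤ i := by
  obtain ⟨h1, h2, h3⟩ := h
  by_contra! hlt
  induction l using Fin.cases with
  | zero => simp at hlt
  | succ l =>
    induction i using Fin.cases with
    | zero => exact h1 h2
    | succ i =>
      rw [oneCross_succ, Fin.succ_lt_succ_iff] at hlt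
      rw [succ_mem_regionL_oneCross_iff hπ', mem_diagram_iff] at h1
      have hle : π'.symm i ≤ l := not_lt.1 fun h => h1 ⟨hlt, h⟩
      have hne : π'.symm i ≠ l := by
        rintro rfl
        simp at hlt
      have h4 := h3 _ (Fin.succ_lt_succ_iff.2 (lt_of_le_of_ne hle hne))
      rw [succ_mem_regionL_oneCross_iff hπ', mem_diagram_iff] at h4
      simp at h4

open Classical in
/-- The lower triangular factor of the indicator matrix of the region `L`. -/
noncomputable def indicatorLower (π : Equiv.Perm (Fin (n + 1)))
    (L : Set (Fin (n + 1) × Fin (n + 1))) : Matrix (Fin (n + 1)) (Fin (n + 1)) ℂ :=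
  Matrix.of fun i r => if π.symm r = 0 then (if (i, 0) ∈ L then 1 else 0)
    else if RowEndsAt L i (π.symm r) then -1 else 0

open Classical in
/-- The upper triangular factor of the indicator matrix of the region `L`. -/
noncomputable def indicatorUpper (L : Set (Fin (n + 1) × Fin (n + 1))) :
    Matrix (Fin (n + 1)) (Fin (n + 1)) ℂ :=
  Matrix.of fun l j => if l ≤ j ∧ (0, j) ∈ L then 1 else 0

-- The `l = 0` term fills a row that meets `L` with ones as far as row `0` of `L` reaches; the `-1`
-- at the end of the row removes the excess.
open Classical in
theorem sum_indicatorLower_mul_indicatorUpper (π : Equiv.Perm (Fin (n + 1)))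
    {L : Set (Fin (n + 1) × Fin (n + 1))} (hL : IsLowerSet L) (i j : Fin (n + 1)) :
    ∑ l, indicatorLower π L i (π l) * indicatorUpper L l j = if (i, j) ∈ L then 1 else 0 := by
  have hrow : ∀ {i k l}, k ≤ l → (i, l) ∈ L → (i, k) ∈ L := fun {i k l} h h' =>
    hL (show (i, k) ≤ (i, l) from ⟨le_rfl, h⟩) h'
  have hcol : ∀ {i j}, (i, j) ∈ L → (0, j) ∈ L := fun {i j} h =>
    hL (show (0, j) ≤ (i, j) from ⟨Fin.zero_le _, le_rfl⟩) h
  simp only [indicatorLower, indicatorUpper, Matrix.of_apply, Equiv.symm_apply_apply]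
  by_cases hij : (i, j) ∈ L
  · rw [Finset.sum_eq_single 0]
    · simp [hij, hrow (Fin.zero_le j) hij, hcol hij]
    · intro l _ hl
      by_cases hlj : l ≤ j
      · have : ¬ RowEndsAt L i l := fun h => h.1 (hrow hlj hij)
        simp [hl, this]
      · simp [hlj]
    · simp
  · rw [if_neg hij]
    by_cases h0j : (0, j) ∈ L
    swap
    · simp [h0j]
    by_cases hi0 : (i, 0) ∈ L
    swap
    · refine Finset.sum_eq_zero fun l _ => ?_
      by_cases hl : l = 0
      · simp [hl, hi0]
      · have : ¬ RowEndsAt L i l := fun h => hi0 (h.2.2 0 (Fin.pos_iff_ne_zero.2 hl))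
        simp [hl, this]
    obtain ⟨m, hm, hmin⟩ : ∃ m, (i, m) ∉ L ∧ ∀ k < m, (i, k) ∈ L := by
      have hne : (Finset.univ.filter fun m => (i, m) ∉ L).Nonempty := ⟨j, by simpa using hij⟩
      refine ⟨_, (Finset.mem_filter.1 (Finset.min'_mem _ hne)).2, fun k hk => ?_⟩
      by_contra h
      exact absurd (Finset.min'_le _ k (by simpa using h)) (not_le.2 hk)
    have hmj : m ≤ j := not_lt.1 fun h => hij (hmin j h)
    have hm0 : m ≠ 0 := by rintro rfl; exact hm hi0
    have hend : RowEndsAt L i m := ⟨hm, hL (show (0, m) ≤ (0, j) from ⟨le_rfl, hmj⟩) h0j, hmin⟩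
    rw [Finset.sum_eq_add 0 m hm0.symm]
    · simp [hi0, h0j, hm0, hend, hmj]
    · rintro l - ⟨hl, hlm⟩
      have : ¬ RowEndsAt L i l := fun h => by
        rcases lt_or_gt_of_ne hlm with h' | h'
        · exact h.1 (hmin l h')
        · exact hm (h.2.2 m h')
      simp [hl, this]
    · simp
    · simp

/-- Filling a point of the torus orbit with zeros gives a point of the matrix Schubert variety. -/
theorem zeroFill_mem_matrixSchubert (hπ' : IsDominant π') (a c : Fin (n + 1) → ℂ)
    (M : Fin (n + 1) × Fin (n + 1) → ℂ)
    (hM : ∀ b ∈ regionL (oneCross π'), M b = a b.1 * c b.2)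
    (hM0 : ∀ b ∉ regionL (oneCross π'), M b = 0) : M ∈ matrixSchubert (oneCross π') := by
  classical
  have := mul_permMat_mul_mem_matrixSchubert (oneCross π')
    (A := Matrix.of fun i r => a i * indicatorLower (oneCross π') (regionL (oneCross π')) i r)
    (B := Matrix.of fun l j => indicatorUpper (regionL (oneCross π')) l j * c j) ?_ ?_
  · convert this using 1
    funext ⟨i, j⟩
    have h := sum_indicatorLower_mul_indicatorUpper (oneCross π')
      (isLowerSet_regionL_oneCross (π' := π')) i j
    rw [mul_permMat_mul_apply]
    simp only [Matrix.of_apply]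
    have h' : ∀ x y : ℂ, a i * x * (y * c j) = (a i * c j) * (x * y) := fun x y => by ring
    simp only [h', ← Finset.mul_sum]
    rw [h]
    split_ifs with hb
    · rw [hM _ hb, mul_one]
    · rw [hM0 _ hb, mul_zero]
  · intro i r hir
    obtain ⟨l, rfl⟩ := (oneCross π').surjective r
    simp only [indicatorLower, Matrix.of_apply, Equiv.symm_apply_apply]
    have hl : l ≠ 0 := by
      rintro rfl
      simp at hir
    have : ¬ RowEndsAt (regionL (oneCross π')) i l := fun h =>
      absurd (h.oneCross_le hπ') (not_le.2 hir)
    simp [hl, this]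
  · intro l j hjl
    simp [indicatorUpper, not_le.2 hjl]

/-- Triangularity kills every term of an entry over `L` except that of the corner `1`, which gives
one inclusion. For the other, extension by zero is a polynomial section of the projection, so it
carries the closure of the torus orbit into the matrix Schubert variety. -/
theorem schubertY_oneCross (hπ' : IsDominant π') :
    schubertY (oneCross π') = zariskiClosure (onesOrbit (regionL (oneCross π'))) := by
  classical
  apply Set.Subset.antisymm
  · rintro _ ⟨M, hM, rfl⟩
    have := polynomialMap_mem_zariskiClosure (S := borelOrbit (oneCross π'))
      (T := onesOrbit (regionL (oneCross π'))) (fun b => X b.1) (fun N hN => ?_) hM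
    · simpa using this
    obtain ⟨A, B, hA, hB, hN⟩ := hN
    have hB' : ∀ i j, j < i →
        ((B⁻¹ : GL (Fin (n + 1)) ℂ) : Matrix (Fin (n + 1)) (Fin (n + 1)) ℂ) i j = 0 := by
      intro i j hij
      have : Invertible (B : Matrix (Fin (n + 1)) (Fin (n + 1)) ℂ) := B.invertible
      rw [Matrix.coe_units_inv]
      exact Matrix.blockTriangular_inv_of_blockTriangular (b := id)
        (fun i j hij => hB i j hij) hij
    have := rankOne_mem_zariskiClosure_onesOrbit (regionL (oneCross π'))
      isLowerSet_regionL_oneCross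
      (fun i => (A : Matrix (Fin (n + 1)) (Fin (n + 1)) ℂ) i 0)
      (fun j => ((B⁻¹ : GL (Fin (n + 1)) ℂ) : Matrix (Fin (n + 1)) (Fin (n + 1)) ℂ) 0 j)
    convert this using 1
    funext ⟨⟨i, j⟩, hb⟩
    simp only [aeval_X, hN, mul_permMat_mul_apply]
    rw [Finset.sum_eq_single 0]
    · simp
    · intro l _ hl
      by_cases hlj : l ≤ j
      · rw [hA _ _ (not_le.1 fun h => hl (eq_zero_of_mem_regionL hπ' hb hlj h)), zero_mul]
      · rw [hB' _ _ (not_le.1 hlj), mul_zero]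
    · simp
  · intro y hy
    refine ⟨fun b => if h : b ∈ regionL (oneCross π') then y ⟨b, h⟩ else 0, ?_, ?_⟩
    · have := polynomialMap_mem_zariskiClosure (T := borelOrbit (oneCross π'))
        (fun b => if h : b ∈ regionL (oneCross π') then
          (X ⟨b, h⟩ : MvPolynomial (regionL (oneCross π')) ℂ) else 0) (fun z hz => ?_) hy
      · refine Set.mem_of_eq_of_mem ?_ this
        funext b
        split_ifs <;> simp
      · obtain ⟨a, c, -, -, hac⟩ := (mem_onesOrbit_iff _ z).1 hz
        refine zeroFill_mem_matrixSchubert hπ' a c _ (fun b hb => ?_) (fun b hb => ?_)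
        · simp [hb, hac]
        · simp [hb]
    · funext b
      simp

end OneCross

end MatrixSchubert

/-- For a dominant permutation `π'` of `{2, …, n + 1}` (written on `Fin n`), the variety
`Y_{1π'}` is toric. -/
theorem corollary3p6 (n : ℕ) (π' : Equiv.Perm (Fin n))
    (hπ' : MatrixSchubert.IsDominant π') :
    MatrixSchubert.IsToricVariety
      (MatrixSchubert.schubertY (MatrixSchubert.oneCross π')) := by
  rw [MatrixSchubert.schubertY_oneCross hπ']
  exact MatrixSchubert.isToricVariety_zariskiClosure_onesOrbit
    MatrixSchubert.isLowerSet_regionL_oneCross
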